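/- All locally compact groups are assumed Hausdorff; a locally compact group is compactly generated if it is generated, as a group, by a compact subset. Let $H$ be a locally compact group, $K,L\subset H$ open subgroups and $\varphi:K\to L$ an isomorphism of topological groups. The HNN-extension $\mathrm{HNN}(H,K,L,\varphi)=\langle H,t\mid tkt^{-1}=\varphi(k)\ \forall k\in K\rangle$ is endowed with the unique group topology for which $H$ is an open subgroup. A locally compact group $G$ splits as an HNN-extension over an open subgroup $H$ if there are such $K,L,\varphi$ for which the pair $(G,H)$ is isomorphic, as a pair of topological groups, to $(\mathrm{HNN}(H,K,L,\varphi),H)$. **Theorem.** Let $G=G_\infty$ be a compactly generated locally compact group with a continuous surjective homomorphism $\pi=\pi_\infty:G\to\mathbf Z$. Then there exist a sequence $(G_n)_{n\ge 0}$ of locally compact groups with continuous surjective homomorphisms $\pi_n:G_n\to\mathbf Z$, and continuous surjective homomorphisms $\varphi_{m,n}:G_m\to G_n$ with discrete kernels for $m\le n\le\infty$, such that: 1. $\varphi_{m,n}\circ\varphi_{\ell,m}=\varphi_{\ell,n}$ for all $\ell\le m\le n\le\infty$, and $\pi_m=\pi_n\circ\varphi_{m,n}$ for all $m\le n\le\infty$;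 2. $G$ is the direct limit of the sequence $(G_n)_{n<\infty}$ as a topological group: the maps $\varphi_{m,\infty}$ ($m<\infty$) are open, and $\mathrm{Ker}(\varphi_{m,\infty})=\bigcup_{m\le n<\infty}\mathrm{Ker}(\varphi_{m,n})$ for every $m<\infty$; 3. for every $n<\infty$, $G_n$ splits as an HNN-extension over some compactly generated open subgroup of $\mathrm{Ker}(\pi_n)$. -/

import Mathlib

open Topology

universe u

/-- A topological group is compactly generated if it is generated, as a group, by a compact
subset. -/
def IsCompactlyGeneratedGroup (G : Type*) [Group G] [TopologicalSpace G] : Prop :=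
  ∃ S : Set G, IsCompact S ∧ Subgroup.closure S = ⊤

/-- The HNN-extension `HNN(H, K, L, φ) = ⟨H, t ∣ t k t⁻¹ = φ k for all k ∈ K⟩` of a topological
group `H`, for an isomorphism of topological groups `φ` between two open subgroups `K` and `L`
of `H`. The underlying group is Mathlib's `HNNExtension`. -/
def TopHNN (H : Type*) [Group H] [TopologicalSpace H] (K L : OpenSubgroup H)
    (φ : (K : Subgroup H) ≃ₜ* (L : Subgroup H)) : Type _ :=
  HNNExtension H (K : Subgroup H) (L : Subgroup H) φ.toMulEquiv

namespace TopHNN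

variable {H : Type*} [Group H] [TopologicalSpace H] {K L : OpenSubgroup H}
  {φ : (K : Subgroup H) ≃ₜ* (L : Subgroup H)}

instance : Group (TopHNN H K L φ) :=
  inferInstanceAs (Group (HNNExtension H (K : Subgroup H) (L : Subgroup H) φ.toMulEquiv))

/-- The canonical homomorphism from `H` to the HNN-extension. -/
def of : H →* TopHNN H K L φ :=
  HNNExtension.of (A := (K : Subgroup H)) (B := (L : Subgroup H)) (φ := φ.toMulEquiv)

/-- The stable letter of the HNN-extension. -/
def t : TopHNN H K L φ :=
  HNNExtension.t (G := H) (A := (K : Subgroup H)) (B := (L : Subgroup H)) (φ := φ.toMulEquiv)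

theorem of_injective : Function.Injective (of : H →* TopHNN H K L φ) :=
  HNNExtension.of_injective (A := (K : Subgroup H)) (B := (L : Subgroup H)) (φ := φ.toMulEquiv)

theorem of_equiv (k : (K : Subgroup H)) :
    (of (φ k : H) : TopHNN H K L φ) = t * of (k : H) * t⁻¹ :=
  HNNExtension.equiv_eq_conj (φ := φ.toMulEquiv) k

theorem of_equiv_symm (l : (L : Subgroup H)) :
    (of (φ.symm l : H) : TopHNN H K L φ) = t⁻¹ * of (l : H) * t :=
  HNNExtension.equiv_symm_eq_conj (φ := φ.toMulEquiv) l

/-- Conjugation in the HNN-extension is compatible with the neighbourhoods of `1` in `H`. -/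
theorem exists_conj [IsTopologicalGroup H] (x : TopHNN H K L φ) (U : Set H) (hU : U ∈ 𝓝 (1 : H)) :
    ∃ V ∈ 𝓝 (1 : H), ∀ v ∈ V, ∃ u ∈ U, (of u : TopHNN H K L φ) = x * of v * x⁻¹ := by
  let P : TopHNN H K L φ → Prop := fun y => ∀ U ∈ 𝓝 (1 : H),
    ∃ V ∈ 𝓝 (1 : H), ∀ v ∈ V, ∃ u ∈ U, (of u : TopHNN H K L φ) = y * of v * y⁻¹
  have hmul : ∀ y z, P y → P z → P (y * z) := by
    intro y z hy hz U hU
    obtain ⟨V, hV, h1⟩ := hy U hU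
    obtain ⟨W, hW, h2⟩ := hz V hV
    refine ⟨W, hW, fun w hw => ?_⟩
    obtain ⟨v, hv, e⟩ := h2 w hw
    obtain ⟨u, hu, e'⟩ := h1 v hv
    exact ⟨u, hu, by rw [e', e]; group⟩
  have hof : ∀ g : H, P (of g) := by
    intro g U hU
    have hc : ContinuousAt (fun v : H => g * v * g⁻¹) 1 := by fun_prop
    exact ⟨(fun v : H => g * v * g⁻¹) ⁻¹' U, hc.preimage_mem_nhds (by simpa using hU),
      fun v hv => ⟨_, hv, by simp⟩⟩
  have ht : P t := by
    intro U hU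
    have hc : ContinuousAt (fun k : (K : Subgroup H) => (φ k : H)) 1 := by fun_prop
    have h1 : (fun k : (K : Subgroup H) => (φ k : H)) ⁻¹' U ∈ 𝓝 (1 : (K : Subgroup H)) :=
      hc.preimage_mem_nhds (by simpa using hU)
    refine ⟨_, K.isOpen.isOpenEmbedding_subtypeVal.image_mem_nhds.2 h1, ?_⟩
    rintro _ ⟨k, hk, rfl⟩
    exact ⟨_, hk, of_equiv k⟩
  have ht' : P t⁻¹ := by
    intro U hU
    have hc : ContinuousAt (fun k : (L : Subgroup H) => (φ.symm k : H)) 1 := by fun_prop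
    have h1 : (fun k : (L : Subgroup H) => (φ.symm k : H)) ⁻¹' U ∈ 𝓝 (1 : (L : Subgroup H)) :=
      hc.preimage_mem_nhds (by simpa using hU)
    refine ⟨_, L.isOpen.isOpenEmbedding_subtypeVal.image_mem_nhds.2 h1, ?_⟩
    rintro _ ⟨k, hk, rfl⟩
    exact ⟨_, hk, by rw [inv_inv]; exact of_equiv_symm k⟩
  have key : P x ∧ P x⁻¹ := by
    refine HNNExtension.induction_on (A := (K : Subgroup H)) (B := (L : Subgroup H))
      (φ := φ.toMulEquiv) (motive := fun y => P y ∧ P (y⁻¹ : TopHNN H K L φ)) x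
      ?_ ⟨ht, ht'⟩ ?_ ?_
    · intro g
      refine ⟨hof g, ?_⟩
      have := hof g⁻¹
      rwa [map_inv] at this
    · rintro y z ⟨hy, hy'⟩ ⟨hz, hz'⟩
      refine ⟨hmul y z hy hz, ?_⟩
      have e : ((y * z)⁻¹ : TopHNN H K L φ) = z⁻¹ * y⁻¹ := mul_inv_rev _ _
      exact e.symm ▸ hmul _ _ hz' hy'
    · rintro y ⟨hy, hy'⟩
      refine ⟨hy', ?_⟩
      have e : ((y⁻¹)⁻¹ : TopHNN H K L φ) = y := inv_inv _
      exact e.symm ▸ hy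
  exact key.1 U hU

/-- The images in the HNN-extension of the neighbourhoods of `1` in `H`. -/
abbrev basis (H : Type*) [Group H] [TopologicalSpace H] [IsTopologicalGroup H] (K L : OpenSubgroup H)
    (φ : (K : Subgroup H) ≃ₜ* (L : Subgroup H)) : GroupFilterBasis (TopHNN H K L φ) where
  sets := {W | ∃ U ∈ 𝓝 (1 : H), W = of '' U}
  nonempty := ⟨_, Set.univ, Filter.univ_mem, rfl⟩
  inter_sets := by
    rintro _ _ ⟨U, hU, rfl⟩ ⟨V, hV, rfl⟩
    exact ⟨_, ⟨U ∩ V, Filter.inter_mem hU hV, rfl⟩, Set.image_inter_subset _ _ _⟩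
  one' := by
    rintro _ ⟨U, hU, rfl⟩
    exact ⟨1, mem_of_mem_nhds hU, map_one _⟩
  mul' := by
    rintro _ ⟨U, hU, rfl⟩
    obtain ⟨V, hV, hVU⟩ := exists_nhds_one_split hU
    refine ⟨_, ⟨V, hV, rfl⟩, ?_⟩
    rintro _ ⟨_, ⟨a, ha, rfl⟩, _, ⟨b, hb, rfl⟩, rfl⟩
    exact ⟨a * b, hVU a ha b hb, map_mul _ _ _⟩
  inv' := by
    rintro _ ⟨U, hU, rfl⟩
    refine ⟨_, ⟨U⁻¹, inv_mem_nhds_one H hU, rfl⟩, ?_⟩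
    rintro _ ⟨a, ha, rfl⟩
    exact ⟨a⁻¹, ha, map_inv _ _⟩
  conj' := by
    rintro x _ ⟨U, hU, rfl⟩
    obtain ⟨V, hV, h⟩ := exists_conj x U hU
    refine ⟨_, ⟨V, hV, rfl⟩, ?_⟩
    rintro _ ⟨v, hv, rfl⟩
    obtain ⟨u, hu, e⟩ := h v hv
    exact ⟨u, hu, e⟩

/-- The topology of the HNN-extension: the group topology for which the images of the
neighbourhoods of `1` in `H` form a basis of neighbourhoods of `1`. By `isOpenEmbedding_of` and
`topology_unique` below, it is the unique group topology in which `H` is an open subgroup. -/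
instance topology [IsTopologicalGroup H] : TopologicalSpace (TopHNN H K L φ) :=
  (basis H K L φ).topology

instance [IsTopologicalGroup H] : IsTopologicalGroup (TopHNN H K L φ) :=
  (basis H K L φ).isTopologicalGroup

theorem nhds_one_eq [IsTopologicalGroup H] :
    𝓝 (1 : TopHNN H K L φ) = (𝓝 (1 : H)).map of := by
  ext W
  rw [(basis H K L φ).nhds_one_hasBasis.mem_iff, Filter.mem_map]
  constructor
  · rintro ⟨_, ⟨U, hU, rfl⟩, h⟩
    exact Filter.mem_of_superset hU (Set.image_subset_iff.1 h)
  · intro h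
    exact ⟨_, ⟨_, h, rfl⟩, Set.image_preimage_subset _ _⟩

/-- `H` is an open subgroup of the HNN-extension. -/
theorem isOpenEmbedding_of [IsTopologicalGroup H] :
    IsOpenEmbedding (of : H → TopHNN H K L φ) := by
  refine .of_continuous_injective_isOpenMap ?_ of_injective ?_
  · refine continuous_of_continuousAt_one (of : H →* TopHNN H K L φ) ?_
    rw [ContinuousAt, map_one, nhds_one_eq]
    exact Filter.tendsto_map
  · refine (IsTopologicalGroup.isOpenMap_iff_nhds_one
      (f := (of : H →* TopHNN H K L φ))).2 ?_
    rw [nhds_one_eq]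

/-- A group topology on the HNN-extension in which `H` is an open subgroup is the above one. -/
theorem topology_unique [IsTopologicalGroup H] (τ : TopologicalSpace (TopHNN H K L φ))
    (hτ : @IsTopologicalGroup _ τ _)
    (hof : @IsOpenEmbedding _ _ _ τ (of : H → TopHNN H K L φ)) :
    τ = topology := by
  refine IsTopologicalGroup.ext hτ inferInstance ?_
  have h := @IsOpenEmbedding.map_nhds_eq _ _ _ _ τ hof 1
  rw [map_one] at h
  exact h.symm.trans nhds_one_eq.symm

end TopHNN

/-- The topological group `G` splits as an HNN-extension over the open subgroup `H`: for some open
subgroups `K`, `L` of `H` and some isomorphism of topological groups `φ : K ≃ L`, the pair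
`(G, H)` is isomorphic, as a pair of topological groups, to `(HNN(H, K, L, φ), H)`. -/
def SplitsAsHNN (G : Type*) [Group G] [TopologicalSpace G] [IsTopologicalGroup G]
    (H : Subgroup G) : Prop :=
  IsOpen (H : Set G) ∧
    ∃ (K L : OpenSubgroup H) (φ : (K : Subgroup H) ≃ₜ* (L : Subgroup H))
      (e : TopHNN H K L φ ≃ₜ* G),
      Subgroup.map e.toMulEquiv.toMonoidHom (TopHNN.of (φ := φ)).range = H

/-- A sequence of topological groups `G 0 → G 1 → ⋯` (with transition homomorphisms `f`), together
with surjective continuous homomorphisms `g n : G n → L` compatible with the transition maps,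
exhibits `L` as the direct limit of the sequence: `L` has the quotient topology, and an element
of `G m` dies in `L` only if it already dies in some `G n`. -/
def IsDirectLimitOfSurjections {G : ℕ → Type*} [∀ n, Group (G n)] [∀ n, TopologicalSpace (G n)]
    {L : Type*} [Group L] [TopologicalSpace L]
    (f : ∀ m n : ℕ, m ≤ n → (G m →ₜ* G n)) (g : ∀ n, G n →ₜ* L) : Prop :=
  (∀ (m n : ℕ) (h : m ≤ n), (g n).comp (f m n h) = g m) ∧
  (∀ n, IsOpenQuotientMap (g n)) ∧
  ∀ (m : ℕ) (x : G m), g m x = 1 → ∃ (n : ℕ) (h : m ≤ n), f m n h x = 1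

/-!
Choose `t : G` with `π t` the generator of `ℤ`. Multiplying a compact generating set by powers of
`t` and adding a compact neighbourhood of `1`, one finds a compact neighbourhood `S` of `1` in
`ker π` such that `t` and `S` generate `G`. The subgroups `H n` generated by the conjugates
`t ^ i * s * t ^ (-i)`, `s ∈ S`, `0 ≤ i ≤ n`, are open, compactly generated and contained in
`ker π`. Let `G n` be the HNN-extension of `H n` in which the stable letter conjugates
`H n ∩ t⁻¹ H n t` to `t H n t⁻¹ ∩ H n` as `t` does. All the homomorphisms `G m → G n → G` are
given by the inclusions on the vertex groups, whence their continuity and the discreteness of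
their kernels (`TopHNN.discreteTopology_ker`); the map `G m → G n` is onto because in `G n` the
relations express the generators of `H n` by those of `H 0` and the stable letter
(`ConjHNN.map_surjective`).

The point is that the kernel of `G m → G` dies in the limit. Since `t H n t⁻¹ ≤ H (n + 1)`, in
`G (n + 1)` the stable letter conjugates every `h ∈ H n` to the element `t h t⁻¹` of `H (n + 1)`:
in the limit, it conjugates the union of the `H n` into itself. Hence each element of `G m`
becomes of the form `t⁻ᵃ h tᵇ` with `a b : ℕ` and `h ∈ H n` in some `G n`
(`ConjHNN.hasNormalForm`). If its image in `G` is trivial, then applying `π` gives `a = b`, so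
`h = 1`, and it is trivial in `G n` (`ConjHNN.exists_transition_eq_one`).
-/

/-! ### Homomorphisms out of an HNN-extension -/

namespace TopHNN

variable {H : Type*} [Group H] [TopologicalSpace H] {K L : OpenSubgroup H}
  {φ : (K : Subgroup H) ≃ₜ* (L : Subgroup H)}

theorem eq_top_of_mem {P : Subgroup (TopHNN H K L φ)} (hof : ∀ h, of h ∈ P) (ht : t ∈ P) :
    P = ⊤ :=
  (Subgroup.eq_top_iff' P).2 fun x =>
    HNNExtension.induction_on (A := (K : Subgroup H)) (B := (L : Subgroup H))
      (φ := φ.toMulEquiv) (motive := fun y => y ∈ P) x hof ht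
      (fun _ _ => P.mul_mem) (fun _ => P.inv_mem)

variable [IsTopologicalGroup H] {M : Type*} [Group M]

theorem continuous_iff_comp_of [TopologicalSpace M] [IsTopologicalGroup M]
    (f : TopHNN H K L φ →* M) :
    Continuous f ↔ Continuous (fun h : H => f (of h)) := by
  refine ⟨fun h => h.comp isOpenEmbedding_of.continuous, fun h => ?_⟩
  refine continuous_of_continuousAt_one f ?_
  rw [ContinuousAt, map_one, nhds_one_eq, Filter.tendsto_map'_iff]
  simpa [ContinuousAt, Function.comp_def] using h.continuousAt (x := 1)

/-- The universal property of the HNN-extension in topological groups. -/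
def lift [TopologicalSpace M] [IsTopologicalGroup M] (f : H →ₜ* M) (x : M)
    (hx : ∀ k : (K : Subgroup H), x * f k = f (φ k : H) * x) : TopHNN H K L φ →ₜ* M where
  toMonoidHom := HNNExtension.lift (A := (K : Subgroup H)) (B := (L : Subgroup H))
    (φ := φ.toMulEquiv) f.toMonoidHom x hx
  continuous_toFun := by
    refine (continuous_iff_comp_of (φ := φ) _).2 ?_
    refine f.continuous_toFun.congr fun h => ?_
    exact (HNNExtension.lift_of f.toMonoidHom x hx h).symm

@[simp]
theorem lift_of [TopologicalSpace M] [IsTopologicalGroup M] (f : H →ₜ* M) (x : M)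
    (hx : ∀ k : (K : Subgroup H), x * f k = f (φ k : H) * x) (h : H) :
    lift f x hx (of h) = f h :=
  HNNExtension.lift_of f.toMonoidHom x hx h

@[simp]
theorem lift_t [TopologicalSpace M] [IsTopologicalGroup M] (f : H →ₜ* M) (x : M)
    (hx : ∀ k : (K : Subgroup H), x * f k = f (φ k : H) * x) :
    lift f x hx t = x :=
  HNNExtension.lift_t f.toMonoidHom x hx

theorem hom_ext [TopologicalSpace M] {f g : TopHNN H K L φ →ₜ* M}
    (hof : ∀ h : H, f (of h) = g (of h))
    (ht : f t = g t) : f = g := by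
  have : f.toMonoidHom = g.toMonoidHom :=
    HNNExtension.hom_ext (A := (K : Subgroup H)) (B := (L : Subgroup H)) (φ := φ.toMulEquiv)
      (MonoidHom.ext hof) ht
  exact ContinuousMonoidHom.ext fun x => DFunLike.congr_fun this x

/-- A homomorphism that is injective on the open subgroup `H` has a discrete kernel. -/
theorem discreteTopology_ker (f : TopHNN H K L φ →* M)
    (hf : Function.Injective fun h : H => f (of h)) : DiscreteTopology f.ker := by
  refine discreteTopology_of_isOpen_singleton_one ?_
  convert (isOpenEmbedding_of (φ := φ)).isOpen_range.preimage
    (continuous_subtype_val (p := fun x => x ∈ f.ker))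
  ext ⟨x, hx⟩
  constructor
  · rintro h
    exact ⟨1, by rw [map_one]; exact (congrArg Subtype.val (Set.mem_singleton_iff.1 h)).symm⟩
  · rintro ⟨h, rfl⟩
    have : h = 1 := hf (by simpa using MonoidHom.mem_ker.1 hx)
    subst this
    exact Subtype.ext (map_one _)

theorem isOpenMap_of_comp_of [TopologicalSpace M] [IsTopologicalGroup M] (f : TopHNN H K L φ →* M)
    (hf : IsOpenMap fun h : H => f (of h)) : IsOpenMap f := by
  refine IsTopologicalGroup.isOpenMap_iff_nhds_one.2 ?_
  rw [nhds_one_eq, Filter.map_map]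
  simpa [Function.comp_def] using hf.nhds_le 1

instance [T2Space H] : T2Space (TopHNN H K L φ) := by
  refine IsTopologicalGroup.t2Space_of_one_sep fun x hx => ?_
  by_cases h : x ∈ Set.range (of : H → TopHNN H K L φ)
  · obtain ⟨h, rfl⟩ := h
    refine ⟨of '' {h}ᶜ, ?_, ?_⟩
    · rw [nhds_one_eq]
      refine Filter.image_mem_map ?_
      exact isOpen_compl_singleton.mem_nhds fun e =>
        hx (by rw [← Set.mem_singleton_iff.1 e, map_one])
    · rintro ⟨h', hne, e⟩
      exact hne (of_injective e)
  · exact ⟨_, isOpenEmbedding_of.isOpen_range.mem_nhds ⟨1, map_one _⟩, h⟩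

instance [LocallyCompactSpace H] : LocallyCompactSpace (TopHNN H K L φ) := by
  obtain ⟨C, hC, hC1⟩ := exists_compact_mem_nhds (1 : H)
  refine (hC.image isOpenEmbedding_of.continuous).locallyCompactSpace_of_mem_nhds_of_group
    (x := (1 : TopHNN H K L φ)) ?_
  rw [nhds_one_eq]
  exact Filter.image_mem_map hC1

/-! ### An HNN-extension splits over the image of its base group -/

/-- The base group `H`, identified with its image in the HNN-extension. -/
noncomputable def rangeEquiv : H ≃ₜ* (of : H →* TopHNN H K L φ).range where
  toMulEquiv := MonoidHom.ofInjective of_injective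
  continuous_toFun := isOpenEmbedding_of.continuous.subtype_mk _
  continuous_invFun := by
    refine (isOpenEmbedding_of (φ := φ)).isInducing.continuous_iff.2 ?_
    refine continuous_subtype_val.congr fun x => ?_
    exact (congrArg Subtype.val
      ((MonoidHom.ofInjective (of_injective (φ := φ))).apply_symm_apply x)).symm

theorem rangeEquiv_apply_coe (h : H) : (rangeEquiv (φ := φ) h : TopHNN H K L φ) = of h := rfl

theorem of_rangeEquiv_symm (x : (of : H →* TopHNN H K L φ).range) :
    of (rangeEquiv.symm x) = (x : TopHNN H K L φ) := by
  rw [← rangeEquiv_apply_coe, ContinuousMulEquiv.apply_symm_apply]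

/-- The isomorphism between the images of `K` and `L` in the HNN-extension induced by `φ`. The
images are encoded as preimages under the inverse of `rangeEquiv`. -/
noncomputable def rangeIso :
    (K.comap (rangeEquiv (φ := φ)).symm.toMulEquiv.toMonoidHom
      rangeEquiv.symm.continuous_toFun).toSubgroup ≃ₜ*
    (L.comap (rangeEquiv (φ := φ)).symm.toMulEquiv.toMonoidHom
      rangeEquiv.symm.continuous_toFun).toSubgroup where
  toFun x := ⟨rangeEquiv (φ ⟨rangeEquiv.symm x.1, x.2⟩ : H), by
    change rangeEquiv.symm (rangeEquiv _) ∈ L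
    rw [ContinuousMulEquiv.symm_apply_apply]
    exact (φ _).2⟩
  invFun x := ⟨rangeEquiv (φ.symm ⟨rangeEquiv.symm x.1, x.2⟩ : H), by
    change rangeEquiv.symm (rangeEquiv _) ∈ K
    rw [ContinuousMulEquiv.symm_apply_apply]
    exact (φ.symm _).2⟩
  left_inv x := by ext1; simp
  right_inv x := by ext1; simp
  map_mul' x y := by
    ext1
    change rangeEquiv _ = rangeEquiv _ * rangeEquiv _
    rw [← map_mul, ← Subgroup.coe_mul, ← map_mul]
    congr 3
    ext1
    exact map_mul _ _ _
  continuous_toFun := by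
    have h1 := (rangeEquiv (φ := φ)).continuous_toFun
    have h2 := (rangeEquiv (φ := φ)).symm.continuous_toFun
    have h3 := φ.continuous_toFun
    refine Continuous.subtype_mk (h1.comp (continuous_subtype_val.comp (h3.comp ?_))) _
    exact Continuous.subtype_mk (h2.comp continuous_subtype_val) _
  continuous_invFun := by
    have h1 := (rangeEquiv (φ := φ)).continuous_toFun
    have h2 := (rangeEquiv (φ := φ)).symm.continuous_toFun
    have h3 := φ.symm.continuous_toFun
    refine Continuous.subtype_mk (h1.comp (continuous_subtype_val.comp (h3.comp ?_))) _
    exact Continuous.subtype_mk (h2.comp continuous_subtype_val) _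

theorem rangeIso_apply_coe (x) :
    ((rangeIso (φ := φ) x : (of : H →* TopHNN H K L φ).range) : TopHNN H K L φ) =
      of (φ ⟨rangeEquiv.symm x.1, x.2⟩ : H) := rfl

theorem splitsAsHNN_range :
    SplitsAsHNN (TopHNN H K L φ) (of : H →* TopHNN H K L φ).range := by
  refine ⟨isOpenEmbedding_of.isOpen_range, _, _, rangeIso (φ := φ), ?_⟩
  let f : TopHNN _ _ _ (rangeIso (φ := φ)) →ₜ* TopHNN H K L φ :=
    lift ⟨(of : H →* TopHNN H K L φ).range.subtype, continuous_subtype_val⟩ t fun k => by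
      change t * (k.1 : TopHNN H K L φ) = ((rangeIso k).1 : TopHNN H K L φ) * t
      rw [rangeIso_apply_coe, of_equiv, inv_mul_cancel_right, of_rangeEquiv_symm]
  let g : TopHNN H K L φ →ₜ* TopHNN _ _ _ (rangeIso (φ := φ)) :=
    lift ⟨of.comp (rangeEquiv (φ := φ)).toMulEquiv.toMonoidHom,
      isOpenEmbedding_of.continuous.comp rangeEquiv.continuous_toFun⟩ t fun k => by
      have hk : rangeEquiv.symm (rangeEquiv (φ := φ) k) ∈ K := by simp
      have := of_equiv (φ := rangeIso (φ := φ)) ⟨rangeEquiv (φ := φ) k, hk⟩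
      change t * of (rangeEquiv (φ := φ) k) = of (rangeEquiv (φ := φ) (φ k : H)) * t
      rw [← mul_inv_eq_iff_eq_mul, ← this]
      congr 1
      apply Subtype.ext
      rw [rangeIso_apply_coe, rangeEquiv_apply_coe]
      simp
  have hfof : ∀ x, f (of x) = (x : TopHNN H K L φ) := fun x => lift_of _ _ _ x
  have hft : f t = t := lift_t _ _ _
  have hgof : ∀ h, g (of h) = of (rangeEquiv h) := fun x => lift_of _ _ _ x
  have hgt : g t = t := lift_t _ _ _
  have hgf : g.comp f = ContinuousMonoidHom.id _ := by
    refine hom_ext (fun x => ?_) ((congrArg g hft).trans hgt)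
    change g (f (of x)) = of x
    obtain ⟨h, rfl⟩ := rangeEquiv.surjective x
    rw [hfof, rangeEquiv_apply_coe, hgof]
  have hfg : f.comp g = ContinuousMonoidHom.id _ := by
    refine hom_ext (fun x => ?_) ((congrArg f hgt).trans hft)
    change f (g (of x)) = of x
    rw [hgof, hfof, rangeEquiv_apply_coe]
  refine ⟨{ f.toMonoidHom with
    invFun := g
    left_inv := DFunLike.congr_fun hgf
    right_inv := DFunLike.congr_fun hfg
    continuous_toFun := f.continuous_toFun
    continuous_invFun := g.continuous_toFun }, ?_⟩
  ext x
  constructor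
  · rintro ⟨_, ⟨y, rfl⟩, rfl⟩
    exact (hfof y).symm ▸ y.2
  · intro hx
    exact ⟨of ⟨x, hx⟩, ⟨_, rfl⟩, hfof _⟩

end TopHNN

theorem IsCompactlyGeneratedGroup.of_continuousMulEquiv {G H : Type*} [Group G]
    [TopologicalSpace G] [Group H] [TopologicalSpace H] (hG : IsCompactlyGeneratedGroup G)
    (e : G ≃ₜ* H) : IsCompactlyGeneratedGroup H := by
  obtain ⟨T, hT, hgen⟩ := hG
  refine ⟨e '' T, hT.image e.continuous_toFun, ?_⟩
  have := MonoidHom.map_closure e.toMulEquiv.toMonoidHom T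
  rw [hgen, Subgroup.map_top_of_surjective _ e.surjective] at this
  exact this.symm

/-! ### Subgroups generated by successive conjugates of a set -/

/-- The set of the conjugates `t ^ i * s * t ^ (-i)` with `s ∈ S` and `0 ≤ i ≤ n`. -/
def conjSet {G : Type*} [Group G] (S : Set G) (t : G) (n : ℕ) : Set G :=
  ⋃ i ∈ Set.Iic n, (fun s => t ^ i * s * (t ^ i)⁻¹) '' S

theorem mem_conjSet {G : Type*} [Group G] {S : Set G} {t : G} {n : ℕ} {g : G} :
    g ∈ conjSet S t n ↔ ∃ i ≤ n, ∃ s ∈ S, t ^ i * s * (t ^ i)⁻¹ = g := by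
  simp [conjSet]

theorem subset_conjSet {G : Type*} [Group G] (S : Set G) (t : G) (n : ℕ) : S ⊆ conjSet S t n :=
  fun s hs => mem_conjSet.2 ⟨0, n.zero_le, s, hs, by simp⟩

section ConjClosure

variable {G : Type*} [Group G] [TopologicalSpace G] [IsTopologicalGroup G]

theorem isCompact_conjSet {S : Set G} (hS : IsCompact S) (t : G) (n : ℕ) :
    IsCompact (conjSet S t n) :=
  (Set.finite_Iic n).isCompact_biUnion fun i _ => hS.image (by fun_prop)

/-- The subgroup generated by `conjSet S t n`; it is open as it contains the neighbourhood `S`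
of `1`. -/
def conjClosure (S : Set G) (hS : S ∈ 𝓝 1) (t : G) (n : ℕ) : OpenSubgroup G where
  toSubgroup := Subgroup.closure (conjSet S t n)
  isOpen' := Subgroup.isOpen_of_mem_nhds _ <| Filter.mem_of_superset hS <|
    (subset_conjSet S t n).trans Subgroup.subset_closure

variable {S : Set G} (hS : S ∈ 𝓝 1) {t : G}

theorem mem_conjClosure_of_mem {n i : ℕ} (hi : i ≤ n) {s : G} (hs : s ∈ S) :
    t ^ i * s * (t ^ i)⁻¹ ∈ conjClosure S hS t n :=
  Subgroup.subset_closure (mem_conjSet.2 ⟨i, hi, s, hs, rfl⟩)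

theorem subset_conjClosure (n : ℕ) : S ⊆ conjClosure S hS t n :=
  (subset_conjSet S t n).trans Subgroup.subset_closure

theorem conjClosure_mono : Monotone (conjClosure S hS t) := fun _ _ h =>
  Subgroup.closure_mono fun g hg => by
    obtain ⟨i, hi, hg⟩ := mem_conjSet.1 hg
    exact mem_conjSet.2 ⟨i, hi.trans h, hg⟩

theorem conjClosure_le_ker {π : G →* Multiplicative ℤ} (hSπ : ∀ s ∈ S, π s = 1) (n : ℕ) :
    (conjClosure S hS t n : Subgroup G) ≤ π.ker := by
  refine (Subgroup.closure_le _).2 fun g hg => ?_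
  obtain ⟨i, -, s, hs, rfl⟩ := mem_conjSet.1 hg
  simp [MonoidHom.mem_ker, hSπ s hs]

theorem conj_mem_conjClosure_succ {n : ℕ} {g : G} (hg : g ∈ conjClosure S hS t n) :
    t * g * t⁻¹ ∈ conjClosure S hS t (n + 1) := by
  suffices (conjClosure S hS t n : Subgroup G) ≤
      (conjClosure S hS t (n + 1) : Subgroup G).comap (MulAut.conj t).toMonoidHom from this hg
  refine (Subgroup.closure_le _).2 fun g hg => ?_
  obtain ⟨i, hi, s, hs, rfl⟩ := mem_conjSet.1 hg
  have := mem_conjClosure_of_mem hS (t := t) (Nat.succ_le_succ hi) hs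
  change t * (t ^ i * s * (t ^ i)⁻¹) * t⁻¹ ∈ conjClosure S hS t (n + 1)
  convert this using 1
  rw [Nat.succ_eq_add_one, pow_succ']
  group

theorem pow_conj_mem_conjClosure {n : ℕ} {g : G} (hg : g ∈ conjClosure S hS t n) (a : ℕ) :
    t ^ a * g * (t ^ a)⁻¹ ∈ conjClosure S hS t (n + a) := by
  induction a with
  | zero => simpa using hg
  | succ a ih =>
    have := conj_mem_conjClosure_succ hS ih
    rw [pow_succ']
    convert this using 1
    group

theorem isCompactlyGeneratedGroup_conjClosure [T2Space G] (hSc : IsCompact S) (n : ℕ) :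
    IsCompactlyGeneratedGroup (conjClosure S hS t n : Subgroup G) := by
  have hc : IsClosed (Subgroup.closure (conjSet S t n) : Set G) := (conjClosure S hS t n).isClosed
  exact ⟨Subtype.val ⁻¹' conjSet S t n,
    hc.isClosedEmbedding_subtypeVal.isCompact_preimage (isCompact_conjSet hSc t n),
    Subgroup.closure_closure_coe_preimage⟩

end ConjClosure

/-! ### The HNN-extension of an open subgroup defined by conjugation by an element -/

section ConjHNN

variable {G : Type*} [Group G] [TopologicalSpace G] [IsTopologicalGroup G]

/-- The open subgroup `H ∩ t⁻¹ H t` of `H`, of those elements that `t` conjugates into `H`. -/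
def conjSubgroup (H : OpenSubgroup G) (t : G) : OpenSubgroup (H : Subgroup G) :=
  H.comap ((MulAut.conj t).toMonoidHom.comp (H : Subgroup G).subtype)
    (show Continuous fun h : (H : Subgroup G) => t * (h : G) * t⁻¹ by fun_prop)

theorem mem_conjSubgroup {H : OpenSubgroup G} {t : G} {h : (H : Subgroup G)} :
    h ∈ conjSubgroup H t ↔ t * h * t⁻¹ ∈ H := Iff.rfl

/-- Conjugation by `t`, from `H ∩ t⁻¹ H t` to `H ∩ t H t⁻¹`. -/
def conjIso (H : OpenSubgroup G) (t : G) :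
    (conjSubgroup H t : Subgroup (H : Subgroup G)) ≃ₜ*
      (conjSubgroup H t⁻¹ : Subgroup (H : Subgroup G)) where
  toFun h := ⟨⟨t * h * t⁻¹, h.2⟩, by
    change t⁻¹ * (t * (h : G) * t⁻¹) * t⁻¹⁻¹ ∈ H
    simp [mul_assoc]⟩
  invFun h := ⟨⟨t⁻¹ * h * t, by simpa using mem_conjSubgroup.1 h.2⟩, by
    change t * (t⁻¹ * (h : G) * t) * t⁻¹ ∈ H
    simp [mul_assoc]⟩
  left_inv h := by ext; simp [mul_assoc]
  right_inv h := by ext; simp [mul_assoc]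
  map_mul' h k := by ext; simp [mul_assoc]
  continuous_toFun := by
    refine Continuous.subtype_mk (Continuous.subtype_mk ?_ _) _
    fun_prop
  continuous_invFun := by
    refine Continuous.subtype_mk (Continuous.subtype_mk ?_ _) _
    fun_prop

/-- The HNN-extension of the open subgroup `H` of `G` whose stable letter acts on
`H ∩ t⁻¹ H t` as conjugation by `t`. -/
abbrev ConjHNN (H : OpenSubgroup G) (t : G) :=
  TopHNN (H : Subgroup G) (conjSubgroup H t) (conjSubgroup H t⁻¹) (conjIso H t)

namespace ConjHNN

open TopHNN

/-- An element of `H`, viewed in the HNN-extension. -/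
abbrev mk (H : OpenSubgroup G) (t : G) (g : G) (hg : g ∈ H) : ConjHNN H t :=
  of (φ := conjIso H t) ⟨g, hg⟩

theorem mk_congr {H : OpenSubgroup G} {t g g' : G} {hg : g ∈ H} {hg' : g' ∈ H} (h : g = g') :
    mk H t g hg = mk H t g' hg' := by
  subst h
  rfl

theorem mk_mul_mk {H : OpenSubgroup G} {t g g' : G} (hg : g ∈ H) (hg' : g' ∈ H) :
    mk H t g hg * mk H t g' hg' = mk H t (g * g') (mul_mem hg hg') :=
  (map_mul of _ _).symm

theorem t_mul_mk_mul {H : OpenSubgroup G} {t g : G} (hg : g ∈ H) (hg' : t * g * t⁻¹ ∈ H) :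
    TopHNN.t * mk H t g hg * TopHNN.t⁻¹ = mk H t (t * g * t⁻¹) hg' :=
  (of_equiv (φ := conjIso H t) ⟨⟨g, hg⟩, hg'⟩).symm

/-- The homomorphism to `G` that is the inclusion on `H` and sends the stable letter to `t`. -/
def toGroup (H : OpenSubgroup G) (t : G) : ConjHNN H t →ₜ* G :=
  lift ⟨(H : Subgroup G).subtype, continuous_subtype_val⟩ t fun k =>
    (inv_mul_cancel_right (t * (k : G)) t).symm

@[simp]
theorem toGroup_of (H : OpenSubgroup G) (t : G) (h : (H : Subgroup G)) :
    toGroup H t (of h) = h := lift_of _ _ _ h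

@[simp]
theorem toGroup_t (H : OpenSubgroup G) (t : G) : toGroup H t TopHNN.t = t := lift_t _ _ _

/-- The homomorphism between HNN-extensions induced by an inclusion of open subgroups. -/
def map {H H' : OpenSubgroup G} (t : G) (hH : H ≤ H') : ConjHNN H t →ₜ* ConjHNN H' t :=
  lift ⟨of.comp (Subgroup.inclusion hH),
    isOpenEmbedding_of.continuous.comp (continuous_inclusion hH)⟩ TopHNN.t fun k =>
      mul_inv_eq_iff_eq_mul.1 (t_mul_mk_mul (hH k.1.2) (hH (mem_conjSubgroup.1 k.2)))

@[simp]
theorem map_of {H H' : OpenSubgroup G} (t : G) (hH : H ≤ H') (h : (H : Subgroup G)) :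
    map t hH (of h) = of (Subgroup.inclusion hH h) := lift_of _ _ _ h

@[simp]
theorem map_t {H H' : OpenSubgroup G} (t : G) (hH : H ≤ H') :
    map t hH TopHNN.t = TopHNN.t := lift_t _ _ _

theorem map_comp_map {H H' H'' : OpenSubgroup G} (t : G) (hH : H ≤ H') (hH' : H' ≤ H'') :
    (map t hH').comp (map t hH) = map t (hH.trans hH') :=
  hom_ext (fun h => by simp [ContinuousMonoidHom.comp_toFun]; rfl)
    (by simp [ContinuousMonoidHom.comp_toFun])

theorem toGroup_comp_map {H H' : OpenSubgroup G} (t : G) (hH : H ≤ H') :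
    (toGroup H' t).comp (map t hH) = toGroup H t :=
  hom_ext (fun h => by simp [ContinuousMonoidHom.comp_toFun])
    (by simp [ContinuousMonoidHom.comp_toFun])

theorem discreteTopology_ker_toGroup (H : OpenSubgroup G) (t : G) :
    DiscreteTopology (toGroup H t).toMonoidHom.ker :=
  discreteTopology_ker _ fun a b hab => Subtype.ext <| by
    simpa using show toGroup H t (of a) = toGroup H t (of b) from hab

theorem discreteTopology_ker_map {H H' : OpenSubgroup G} (t : G) (hH : H ≤ H') :
    DiscreteTopology (map t hH).toMonoidHom.ker :=
  discreteTopology_ker _ fun a b hab => by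
    have : map t hH (of a) = map t hH (of b) := hab
    rw [map_of, map_of] at this
    exact Subgroup.inclusion_injective hH (of_injective this)

theorem isOpenMap_toGroup (H : OpenSubgroup G) (t : G) : IsOpenMap (toGroup H t) :=
  isOpenMap_of_comp_of (toGroup H t).toMonoidHom <| by
    have : (fun h => (toGroup H t).toMonoidHom (of h)) = (fun h : (H : Subgroup G) => (h : G)) :=
      funext fun h => toGroup_of H t h
    rw [this]
    exact H.isOpen.isOpenEmbedding_subtypeVal.isOpenMap

theorem toGroup_surjective {H : OpenSubgroup G} {t : G} {S : Set G} (hS : S ⊆ (H : Set G))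
    (hgen : Subgroup.closure (insert t S) = ⊤) : Function.Surjective (toGroup H t) := by
  refine (MonoidHom.range_eq_top (f := (toGroup H t).toMonoidHom)).1 (top_le_iff.1 ?_)
  rw [← hgen, Subgroup.closure_le]
  rintro g (rfl | hg)
  · exact ⟨TopHNN.t, toGroup_t H _⟩
  · exact ⟨of ⟨g, hS hg⟩, toGroup_of H t _⟩

end ConjHNN

/-! ### The tower of HNN-extensions -/

namespace ConjHNN

open TopHNN

variable {S : Set G} (hS : S ∈ 𝓝 1) {t : G}

/-- The first `N - n` conjugations of the `n`-th subgroup by `t` are effected by the stable letter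
in the HNN-extension of the `N`-th subgroup. -/
theorem t_pow_mul_mk_mul {n N : ℕ} {g : G} (hg : g ∈ conjClosure S hS t n) (a : ℕ)
    (h : n + a ≤ N) :
    TopHNN.t ^ a * mk (conjClosure S hS t N) t g
      (conjClosure_mono hS (le_self_add.trans h) hg) * (TopHNN.t ^ a)⁻¹ =
      mk (conjClosure S hS t N) t _
        (conjClosure_mono hS h (pow_conj_mem_conjClosure hS hg a)) := by
  induction a with
  | zero => simp
  | succ a ih =>
    have hle : n + a ≤ N := le_trans (by omega) h
    have h1 := pow_conj_mem_conjClosure hS hg a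
    have h2 := conjClosure_mono hS h (conj_mem_conjClosure_succ hS h1)
    calc _ = TopHNN.t * (TopHNN.t ^ a * mk (conjClosure S hS t N) t g
          (conjClosure_mono hS (le_self_add.trans h) hg) * (TopHNN.t ^ a)⁻¹) * TopHNN.t⁻¹ := by
          rw [pow_succ', mul_inv_rev]
          simp only [mul_assoc]
      _ = mk (conjClosure S hS t N) t _ h2 := by
          rw [ih hle]
          exact t_mul_mk_mul (conjClosure_mono hS hle h1) h2
      _ = _ := mk_congr (by rw [pow_succ', mul_inv_rev]; simp only [mul_assoc])

/-- In the larger HNN-extension, the generators of the base group are conjugates of elements of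
`S` by powers of the stable letter, hence are in the image of the smaller one. -/
theorem map_surjective {m n : ℕ} (h : m ≤ n) :
    Function.Surjective (map t (conjClosure_mono hS (t := t) h)) := by
  set f := map t (conjClosure_mono hS (t := t) h) with hf
  refine (MonoidHom.range_eq_top (f := f.toMonoidHom)).1 ?_
  have ht : TopHNN.t ∈ f.toMonoidHom.range := ⟨TopHNN.t, map_t t _⟩
  refine eq_top_of_mem ?_ ht
  suffices (conjClosure S hS t n : Subgroup G) ≤
      (f.toMonoidHom.range.comap of).map (conjClosure S hS t n : Subgroup G).subtype by
    rintro ⟨g, hg⟩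
    obtain ⟨g', hg', rfl⟩ := this hg
    exact hg'
  refine (Subgroup.closure_le _).2 fun g hg => ?_
  obtain ⟨i, hi, s, hs, rfl⟩ := mem_conjSet.1 hg
  refine ⟨⟨_, mem_conjClosure_of_mem hS hi hs⟩, ?_, rfl⟩
  have key := t_pow_mul_mk_mul hS (t := t) (subset_conjClosure hS 0 hs) i
    (by rwa [Nat.zero_add] : 0 + i ≤ n)
  change mk (conjClosure S hS t n) t _ _ ∈ f.toMonoidHom.range
  rw [← key]
  refine mul_mem (mul_mem (pow_mem ht i) ?_) (inv_mem (pow_mem ht i))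
  exact ⟨of ⟨s, subset_conjClosure hS m hs⟩, map_of t _ _⟩

/-- The transition maps of the tower. -/
abbrev transition (S : Set G) (hS : S ∈ 𝓝 1) (t : G) (m n : ℕ) (h : m ≤ n) :
    ConjHNN (conjClosure S hS t m) t →ₜ* ConjHNN (conjClosure S hS t n) t :=
  map t (conjClosure_mono hS h)

theorem transition_transition {l m n : ℕ} (h : l ≤ m) (h' : m ≤ n)
    (x : ConjHNN (conjClosure S hS t l) t) :
    transition S hS t m n h' (transition S hS t l m h x) = transition S hS t l n (h.trans h') x :=
  DFunLike.congr_fun (map_comp_map t (conjClosure_mono hS h) (conjClosure_mono hS h')) x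

/-- The property that the image of `x` at some later stage is of the form `t⁻ᵃ g tᵇ`, with `g` in
the base group. -/
def HasNormalForm (m : ℕ) (x : ConjHNN (conjClosure S hS t m) t) : Prop :=
  ∃ (n : ℕ) (h : m ≤ n) (a b : ℕ) (g : G) (hg : g ∈ conjClosure S hS t n),
    transition S hS t m n h x = (TopHNN.t ^ a)⁻¹ * mk _ t g hg * TopHNN.t ^ b

variable {hS} {m : ℕ} {x : ConjHNN (conjClosure S hS t m) t}

theorem HasNormalForm.t_inv_mul (hx : HasNormalForm hS m x) :
    HasNormalForm hS m (TopHNN.t⁻¹ * x) := by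
  obtain ⟨n, h, a, b, g, hg, e⟩ := hx
  refine ⟨n, h, a + 1, b, g, hg, ?_⟩
  rw [map_mul, map_inv, map_t, e, pow_succ]
  simp only [mul_inv_rev, mul_assoc]

theorem HasNormalForm.t_mul (hx : HasNormalForm hS m x) :
    HasNormalForm hS m (TopHNN.t * x) := by
  obtain ⟨n, h, a, b, g, hg, e⟩ := hx
  cases a with
  | zero =>
    -- The stable letter can be moved across the base group at the cost of passing to stage `n + 1`.
    have hg' := conj_mem_conjClosure_succ hS hg
    refine ⟨n + 1, h.trans n.le_succ, 0, b + 1, _, hg', ?_⟩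
    have hgn := conjClosure_mono hS n.le_succ hg
    have key := t_mul_mk_mul hgn hg'
    have e' : transition S hS t m (n + 1) (h.trans n.le_succ) x =
        mk (conjClosure S hS t (n + 1)) t g hgn * TopHNN.t ^ b := by
      rw [← transition_transition hS h n.le_succ, e]
      simp only [pow_zero, inv_one, one_mul, map_mul, map_pow, map_t, map_of]
      rfl
    rw [map_mul, map_t, e', ← key, pow_succ']
    simp only [pow_zero, inv_one, one_mul, mul_assoc, inv_mul_cancel_left]
  | succ a =>
    refine ⟨n, h, a, b, g, hg, ?_⟩
    rw [map_mul, map_t, e, pow_succ]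
    simp only [mul_inv_rev, mul_assoc, mul_inv_cancel_left]

theorem HasNormalForm.of_mul (hx : HasNormalForm hS m x)
    (k : (conjClosure S hS t m : Subgroup G)) : HasNormalForm hS m (of k * x) := by
  obtain ⟨n, h, a, b, g, hg, e⟩ := hx
  have hk := conjClosure_mono hS h k.2
  have hgn := conjClosure_mono hS (Nat.le_add_right n a) hg
  have hka := pow_conj_mem_conjClosure hS hk a
  have key := t_pow_mul_mk_mul hS hk a le_rfl
  refine ⟨n + a, h.trans le_self_add, a, b, _, mul_mem hka hgn, ?_⟩
  have e' : transition S hS t m (n + a) (h.trans le_self_add) x =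
      (TopHNN.t ^ a)⁻¹ * mk (conjClosure S hS t (n + a)) t g hgn * TopHNN.t ^ b := by
    rw [← transition_transition hS h le_self_add, e]
    simp only [map_mul, map_inv, map_pow, map_t, map_of]
    rfl
  have ek : transition S hS t m (n + a) (h.trans le_self_add) (of k) =
      mk (conjClosure S hS t (n + a)) t k (conjClosure_mono hS le_self_add hk) := map_of t _ _
  rw [map_mul, e', ek, ← mk_mul_mk hka hgn, ← key]
  simp only [mul_assoc, inv_mul_cancel_left]

variable (hS) (x) in
theorem hasNormalForm : HasNormalForm hS m x := by
  let P (y : ConjHNN (conjClosure S hS t m) t) : Prop :=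
    ∀ x, HasNormalForm hS m x → HasNormalForm hS m (y * x)
  suffices h : P x ∧ P x⁻¹ by
    have h1 : HasNormalForm hS m (1 : ConjHNN (conjClosure S hS t m) t) :=
      ⟨m, le_rfl, 0, 0, 1, one_mem _, by
        rw [map_one, show mk (conjClosure S hS t m) t 1 (one_mem _) = 1 from map_one of]
        simp⟩
    simpa using h.1 1 h1
  let Q : Subgroup (ConjHNN (conjClosure S hS t m) t) :=
    { carrier := {y | P y ∧ P y⁻¹}
      one_mem' := by simp [P]
      mul_mem' := fun {y z} hy hz =>
        ⟨fun x hx => by rw [mul_assoc]; exact hy.1 _ (hz.1 _ hx),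
          fun x hx => by rw [mul_inv_rev, mul_assoc]; exact hz.2 _ (hy.2 _ hx)⟩
      inv_mem' := fun {y} hy => ⟨hy.2, by rw [inv_inv]; exact hy.1⟩ }
  have hQ : Q = ⊤ := eq_top_of_mem
    (fun k => ⟨fun x hx => hx.of_mul k, fun x hx => by rw [← map_inv]; exact hx.of_mul k⁻¹⟩)
    ⟨fun x hx => hx.t_mul, fun x hx => hx.t_inv_mul⟩
  exact (Subgroup.eq_top_iff' Q).1 hQ x

/-- An element of the kernel of the map to `G` is killed in the tower. -/
theorem exists_transition_eq_one {π : G →* Multiplicative ℤ} (hSπ : ∀ s ∈ S, π s = 1)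
    (ht : π t = Multiplicative.ofAdd 1) (hx : toGroup (conjClosure S hS t m) t x = 1) :
    ∃ (n : ℕ) (h : m ≤ n), transition S hS t m n h x = 1 := by
  obtain ⟨n, h, a, b, g, hg, e⟩ := hasNormalForm hS x
  refine ⟨n, h, ?_⟩
  have hxe : (t ^ a)⁻¹ * g * t ^ b = 1 := by
    rw [← hx, ← toGroup_comp_map t (conjClosure_mono hS h)]
    change _ = toGroup _ t (transition S hS t m n h x)
    rw [e]
    simp
  have hab : a = b := by
    have hπg : π g = 1 := conjClosure_le_ker hS hSπ n hg
    have := congrArg (fun y => Multiplicative.toAdd (π y)) hxe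
    simp [ht, hπg] at this
    omega
  subst hab
  have hg1 : g = 1 := by
    have := congrArg (fun y => t ^ a * y * (t ^ a)⁻¹) hxe
    simpa [mul_assoc] using this
  subst hg1
  rw [e, show mk (conjClosure S hS t n) t 1 hg = 1 from map_one of]
  simp

end ConjHNN

end ConjHNN

/-! ### Compact generation relative to a homomorphism onto the integers -/

/-- A compact generating set can be moved into the kernel of a homomorphism onto `ℤ` by means of
an element `t` mapped to the generator, and enlarged to a neighbourhood of `1`. -/
theorem IsCompactlyGeneratedGroup.exists_compact_nhds_ker {G : Type*} [Group G]
    [TopologicalSpace G] [IsTopologicalGroup G] [LocallyCompactSpace G]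
    (hG : IsCompactlyGeneratedGroup G) (π : G →ₜ* Multiplicative ℤ) {t : G}
    (ht : π t = Multiplicative.ofAdd 1) :
    ∃ S ∈ 𝓝 (1 : G), IsCompact S ∧ (∀ s ∈ S, π s = 1) ∧ Subgroup.closure (insert t S) = ⊤ := by
  obtain ⟨T, hT, hTgen⟩ := hG
  obtain ⟨C, hC1, hCπ, hC⟩ := local_compact_nhds (x := (1 : G)) (n := π ⁻¹' {1})
    (((isOpen_discrete _).preimage π.continuous_toFun).mem_nhds (map_one π))
  let f : G → G := fun s => s * t ^ (-Multiplicative.toAdd (π s))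
  have hf : Continuous f := by
    refine continuous_id.mul ?_
    exact (continuous_of_discreteTopology
      (f := fun z : Multiplicative ℤ => t ^ (-Multiplicative.toAdd z))).comp π.continuous_toFun
  refine ⟨C ∪ f '' T, Filter.mem_of_superset hC1 Set.subset_union_left,
    hC.union (hT.image hf), ?_, ?_⟩
  · rintro s (hs | ⟨s, -, rfl⟩)
    · exact hCπ hs
    · apply Multiplicative.toAdd.injective
      simp [f, ht]
  · rw [← top_le_iff, ← hTgen, Subgroup.closure_le]
    intro s hs
    have h1 : f s ∈ Subgroup.closure (insert t (C ∪ f '' T)) :=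
      Subgroup.subset_closure (Or.inr (Or.inr ⟨s, hs, rfl⟩))
    have h2 : t ∈ Subgroup.closure (insert t (C ∪ f '' T)) :=
      Subgroup.subset_closure (Or.inl rfl)
    simpa [f] using mul_mem h1 (zpow_mem h2 (Multiplicative.toAdd (π s)))

theorem theorem8p1 {G : Type u} [Group G] [TopologicalSpace G] [IsTopologicalGroup G]
    [T2Space G] [LocallyCompactSpace G] (hG : IsCompactlyGeneratedGroup G)
    (π : G →ₜ* Multiplicative ℤ) (hπ : Function.Surjective π) :
    ∃ (Gn : ℕ → Type u) (_ : ∀ n, Group (Gn n)) (_ : ∀ n, TopologicalSpace (Gn n))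
      (_ : ∀ n, IsTopologicalGroup (Gn n))
      (πn : ∀ n, Gn n →ₜ* Multiplicative ℤ)
      (φ : ∀ m n : ℕ, m ≤ n → (Gn m →ₜ* Gn n))
      (φinf : ∀ n, Gn n →ₜ* G),
      -- the groups are locally compact (and Hausdorff), the `πn` are onto
      (∀ n, T2Space (Gn n) ∧ LocallyCompactSpace (Gn n)) ∧
      (∀ n, Function.Surjective (πn n)) ∧
      -- the transition maps are surjective with discrete kernels
      (∀ (m n : ℕ) (h : m ≤ n), Function.Surjective (φ m n h) ∧
        DiscreteTopology (φ m n h).toMonoidHom.ker) ∧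
      (∀ n, Function.Surjective (φinf n) ∧ DiscreteTopology (φinf n).toMonoidHom.ker) ∧
      -- the transition maps are compatible with each other
      (∀ (l m n : ℕ) (h : l ≤ m) (h' : m ≤ n), (φ m n h').comp (φ l m h) = φ l n (h.trans h')) ∧
      (∀ (m n : ℕ) (h : m ≤ n), (φinf n).comp (φ m n h) = φinf m) ∧
      -- they are compatible with the projections onto `ℤ`
      (∀ (m n : ℕ) (h : m ≤ n), (πn n).comp (φ m n h) = πn m) ∧
      (∀ n, π.comp (φinf n) = πn n) ∧
      -- `G` is the limit of the `Gn`
      IsDirectLimitOfSurjections φ φinf ∧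
      -- the `Gn` are HNN-extensions
      (∀ n, ∃ H : Subgroup (Gn n), H ≤ (πn n).toMonoidHom.ker ∧
        IsCompactlyGeneratedGroup H ∧ SplitsAsHNN (Gn n) H) := by
  obtain ⟨t, ht⟩ := hπ (Multiplicative.ofAdd 1)
  obtain ⟨S, hS, hSc, hSπ, hgen⟩ := hG.exists_compact_nhds_ker π ht
  let H (n : ℕ) : OpenSubgroup G := conjClosure S hS t n
  have hlc (n : ℕ) : LocallyCompactSpace (H n : Subgroup G) := (H n).isOpen.locallyCompactSpace
  have hsurj (n : ℕ) : Function.Surjective (ConjHNN.toGroup (H n) t) :=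
    ConjHNN.toGroup_surjective (subset_conjClosure hS n) hgen
  have hcomp (m n : ℕ) (h : m ≤ n) :
      (ConjHNN.toGroup (H n) t).comp (ConjHNN.transition S hS t m n h) = ConjHNN.toGroup (H m) t :=
    ConjHNN.toGroup_comp_map t (conjClosure_mono hS h)
  refine ⟨fun n => ConjHNN (H n) t, fun n => inferInstance, fun n => inferInstance,
    fun n => inferInstance, fun n => π.comp (ConjHNN.toGroup (H n) t), ConjHNN.transition S hS t,
    fun n => ConjHNN.toGroup (H n) t, fun n => ⟨inferInstance, inferInstance⟩,
    fun n => hπ.comp (hsurj n),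
    fun m n h => ⟨ConjHNN.map_surjective hS h, ConjHNN.discreteTopology_ker_map t _⟩,
    fun n => ⟨hsurj n, ConjHNN.discreteTopology_ker_toGroup _ t⟩,
    fun l m n h h' => ConjHNN.map_comp_map t _ _, hcomp, fun m n h => ?_, fun n => rfl,
    ⟨hcomp, fun n => ⟨hsurj n, (ConjHNN.toGroup (H n) t).continuous_toFun,
      ConjHNN.isOpenMap_toGroup _ t⟩,
      fun m x hx => ConjHNN.exists_transition_eq_one (π := π.toMonoidHom) hSπ ht hx⟩,
    fun n => ⟨_, ?_, ?_, TopHNN.splitsAsHNN_range⟩⟩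
  · exact ContinuousMonoidHom.ext fun x => congrArg π (DFunLike.congr_fun (hcomp m n h) x)
  · rintro _ ⟨h, rfl⟩
    change π (ConjHNN.toGroup (H n) t (TopHNN.of h)) = 1
    rw [ConjHNN.toGroup_of]
    exact conjClosure_le_ker hS (π := π.toMonoidHom) hSπ n h.2
  · exact (isCompactlyGeneratedGroup_conjClosure hS hSc n).of_continuousMulEquiv TopHNN.rangeEquiv
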